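/- A JB-algebra is a real Jordan algebra $A$ with unit $\mathbf 1$ that is a Banach space under a norm with $\|a\circ b\|\le\|a\|\|b\|$, $\|a^2\|=\|a\|^2$ and $\|a^2\|\le\|a^2+b^2\|$; it is ordered by the cone $A^+=\{a^2:a\in A\}$. It is a JBW-algebra if it is isometrically isomorphic to the dual of a Banach space. A trace on $A$ is a map $\tau:A^+\to[0,\infty]$ with $\tau(a+\lambda b)=\tau(a)+\lambda\tau(b)$ for $a,b\in A^+$, $\lambda\ge 0$ (where $0\cdot\infty=0$) and $\tau(U_sa)=\tau(a)$ for $a\in A^+$, $s\in A$, $s^2=\mathbf 1$, where $U_sx=2s\circ(s\circ x)-s^2\circ x$. It is faithful if $\tau(a)>0$ for $0\ne a\in A^+$, normal if $\tau(\sup_\alpha x_\alpha)=\sup_\alpha\tau(x_\alpha)$ for every bounded increasing net in $A^+$, and semi-finite if there is a net in $A^+$ increasing to $\mathbf 1$ on whose members $\tau$ is finite. The space $L_1(A,\tau)$ is the completion of $A_1=\{a\in A:\tau(|a|)<\infty\}$ in the norm $\|a\|_1=\tau(|a|)$, where $|a|$ is the positive square root of $a^2$; it is ordered by the closure of $A_1\cap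 A^+$. A bounded linear operator is positive if it maps positive elements to positive elements, it is a contraction if its norm is at most $1$, and $T\le S$ means that $S-T$ is positive. **Theorem.** (a) Let $A$ be a JBW-algebra with a faithful normal semi-finite trace $\tau$, and let $T,S:L_1(A,\tau)\to L_1(A,\tau)$ be positive contractions with $T\le S$. If $\|S^{n_0}-T^{n_0}\|<1$ for some integer $n_0\ge 1$, then $\|S^n-T^n\|<1$ for every $n\ge n_0$. (b) The same holds for positive contractions $T\le S$ of any partially ordered real Banach space $X$ such that $\|x+y\|=\|x\|+\|y\|$ for all $x,y\ge 0$ in $X$, and $\|R\|=\sup\{\|Rx\|:x\ge 0,\ \|x\|=1\}$ for every positive bounded operator $R$ on $X$ (the supremum of the empty set being $0$). -/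

import Mathlib

open scoped NNReal ENNReal

universe u v

noncomputable section

/-- A (unital, real) JB-algebra: a Jordan algebra with unit which is a Banach space under a
submultiplicative norm with `‖a²‖ = ‖a‖²` and `‖a²‖ ≤ ‖a² + b²‖`.
The Jordan product `a ∘ b` is written `a * b`. -/
class JBAlgebra (A : Type u) extends NormedAddCommGroup A, NonAssocCommRing A, NormedSpace ℝ A,
    CompleteSpace A, IsScalarTower ℝ A A, IsCommJordan A where
  norm_mul_le_mul_norm : ∀ a b : A, ‖a * b‖ ≤ ‖a‖ * ‖b‖
  norm_mul_self : ∀ a : A, ‖a * a‖ = ‖a‖ ^ 2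
  norm_mul_self_le : ∀ a b : A, ‖a * a‖ ≤ ‖a * a + b * b‖

/-- A JBW-algebra: a JB-algebra which is isometrically isomorphic to the dual of a Banach space.
(Every predual embeds isometrically into the dual of `A`, so it is enough to look for it in the
universe of `A`.) -/
class JBWAlgebra (A : Type u) extends JBAlgebra A where
  exists_predual : ∃ (N : Type u) (_ : NormedAddCommGroup N) (_ : NormedSpace ℝ N)
    (_ : CompleteSpace N), Nonempty (A ≃ₗᵢ[ℝ] StrongDual ℝ N)

namespace JBAlgebra

variable {A : Type u} [JBAlgebra A]

/-- The positive cone `A⁺ = {b² : b ∈ A}`. -/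
def IsPos (a : A) : Prop := ∃ b : A, a = b * b

/-- The order of `A`: `a ≤ b` iff `b - a ∈ A⁺`. -/
def Le (a b : A) : Prop := IsPos (b - a)

/-- `x` is the least upper bound of the set `D` for the order of `A`. -/
def IsSup (D : Set A) (x : A) : Prop :=
  (∀ d ∈ D, Le d x) ∧ ∀ y : A, (∀ d ∈ D, Le d y) → Le x y

/-- `U_s x = 2 s ∘ (s ∘ x) - s² ∘ x`. -/
def U (s x : A) : A := (2 : ℝ) • (s * (s * x)) - (s * s) * x

/-- The modulus `|a|`, i.e. the positive square root of `a²`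
(which exists and is unique in a JB-algebra). -/
def modulus (a : A) : A := Classical.epsilon fun b : A => IsPos b ∧ b * b = a * a

end JBAlgebra

open JBAlgebra

/-- A faithful normal semi-finite trace `τ : A⁺ → [0, ∞]`. It is carried by a function on all
of `A`, whose values outside `A⁺` are arbitrary and never matter. An increasing net is represented
by the (nonempty, upward directed) set of its members. -/
structure FNSTrace (A : Type u) [JBAlgebra A] where
  toFun : A → ℝ≥0∞
  map_add_smul : ∀ a b : A, IsPos a → IsPos b → ∀ r : ℝ≥0,
    toFun (a + (r : ℝ) • b) = toFun a + (r : ℝ≥0∞) * toFun b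
  map_U : ∀ a s : A, IsPos a → s * s = 1 → toFun (U s a) = toFun a
  faithful : ∀ a : A, IsPos a → a ≠ 0 → 0 < toFun a
  normal : ∀ (D : Set A) (x : A), (∀ d ∈ D, IsPos d) → D.Nonempty → DirectedOn Le D →
    IsSup D x → toFun x = ⨆ d ∈ D, toFun d
  semifinite : ∃ D : Set A, (∀ d ∈ D, IsPos d) ∧ D.Nonempty ∧ DirectedOn Le D ∧
    IsSup D 1 ∧ ∀ d ∈ D, toFun d < ∞

section L1

variable {A : Type u} [JBAlgebra A]

/-- `τ(|a|)`. -/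
def FNSTrace.absTrace (τ : FNSTrace A) (a : A) : ℝ≥0∞ := τ.toFun (modulus a)

/-- The linear space `A₁` of all `a ∈ A` with `τ(|a|) < ∞` (this set is a linear subspace,
so that it is equal to its span). -/
def FNSTrace.A1 (τ : FNSTrace A) : Submodule ℝ A := Submodule.span ℝ {a : A | τ.absTrace a < ∞}

/-- The space `A₁` as a type of its own, to be normed by `‖a‖₁ = τ(|a|)`
and not by the norm of `A`. -/
def PreL1 (τ : FNSTrace A) : Type u := τ.A1

instance (τ : FNSTrace A) : AddCommGroup (PreL1 τ) := inferInstanceAs (AddCommGroup τ.A1)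

instance (τ : FNSTrace A) : Module ℝ (PreL1 τ) := inferInstanceAs (Module ℝ τ.A1)

/-- The inclusion `A₁ → A`. -/
def PreL1.val {τ : FNSTrace A} : PreL1 τ →ₗ[ℝ] A := τ.A1.subtype

/-- The seminorms on `A₁` that are at most `τ(|a|)` everywhere. -/
def dominatedSeminorms (τ : FNSTrace A) : Set (Seminorm ℝ (PreL1 τ)) :=
  {p | ∀ a, ENNReal.ofReal (p a) ≤ τ.absTrace a.val}

/-- `‖a‖₁ = τ(|a|)` on `A₁`, written as the largest seminorm that is at most `τ(|a|)`.
As `a ↦ τ(|a|)` is a norm on `A₁`, it is that largest seminorm: see `l1Seminorm_eq`.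
Written in this way it is a seminorm by construction. -/
def l1Seminorm (τ : FNSTrace A) : Seminorm ℝ (PreL1 τ) := sSup (dominatedSeminorms τ)

/-- The supremum in `l1Seminorm` is a genuine one. -/
theorem bddAbove_dominatedSeminorms (τ : FNSTrace A) : BddAbove (dominatedSeminorms τ) := by
  rw [Seminorm.bddAbove_iff]
  have key : ∀ (x : A) (hx : x ∈ τ.A1), ∃ c : ℝ, ∀ p ∈ dominatedSeminorms τ,
      p (⟨x, hx⟩ : τ.A1) ≤ c := by
    intro x hx
    induction hx using Submodule.span_induction with
    | mem x hx =>
      refine ⟨(τ.absTrace x).toReal, fun p hp => ?_⟩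
      exact (ENNReal.ofReal_le_iff_le_toReal (ne_of_lt hx)).1 (hp _)
    | zero =>
      refine ⟨0, fun p _ => le_of_eq ?_⟩
      exact map_zero p
    | add x y hx hy ihx ihy =>
      obtain ⟨c, hc⟩ := ihx
      obtain ⟨d, hd⟩ := ihy
      refine ⟨c + d, fun p hp => ?_⟩
      exact (map_add_le_add p (⟨x, hx⟩ : τ.A1) (⟨y, hy⟩ : τ.A1)).trans
        (add_le_add (hc p hp) (hd p hp))
    | smul r x hx ihx =>
      obtain ⟨c, hc⟩ := ihx
      refine ⟨‖r‖ * c, fun p hp => ?_⟩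
      exact (le_of_eq (map_smul_eq_mul p r (⟨x, hx⟩ : τ.A1))).trans
        (mul_le_mul_of_nonneg_left (hc p hp) (norm_nonneg r))
  choose! c hc using key
  refine ⟨fun a => c a.1, ?_⟩
  rintro _ ⟨p, hp, rfl⟩ a
  exact hc a.1 a.2 p hp

/-- `l1Seminorm` is `τ(|·|)`, the latter being a seminorm `q` on `A₁`. -/
theorem l1Seminorm_eq (τ : FNSTrace A) (q : Seminorm ℝ (PreL1 τ))
    (hq : ∀ a : PreL1 τ, ENNReal.ofReal (q a) = τ.absTrace a.val) : l1Seminorm τ = q := by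
  have hmem : q ∈ dominatedSeminorms τ := fun a => (hq a).le
  apply IsLUB.unique (isLUB_csSup ⟨q, hmem⟩ (bddAbove_dominatedSeminorms τ))
  refine IsGreatest.isLUB ⟨hmem, fun p hp a => ?_⟩
  exact (ENNReal.ofReal_le_ofReal_iff (apply_nonneg q a)).1 ((hp a).trans (hq a).ge)

instance (τ : FNSTrace A) : SeminormedAddCommGroup (PreL1 τ) :=
  (l1Seminorm τ).toSeminormedAddCommGroup

instance (τ : FNSTrace A) : NormedSpace ℝ (PreL1 τ) where
  norm_smul_le r a := (map_smul_eq_mul (l1Seminorm τ) r a).le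

/-- `L₁(A, τ)`, the completion of `(A₁, ‖·‖₁)`. -/
abbrev L1 (τ : FNSTrace A) : Type u := UniformSpace.Completion (PreL1 τ)

/-- The positive cone of `L₁(A, τ)`: the closure of `A₁ ∩ A⁺`. -/
def L1.cone (τ : FNSTrace A) : Set (L1 τ) :=
  closure ((fun a : PreL1 τ => (a : L1 τ)) '' {a | IsPos a.val})

end L1

section Operators

variable {X : Type v} [NormedAddCommGroup X] [NormedSpace ℝ X]

/-- `T` is positive for the order with positive cone `P`. -/
def IsPositiveOp (P : Set X) (T : X →L[ℝ] X) : Prop := ∀ x ∈ P, T x ∈ P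

/-- `T` is a positive contraction for the order with positive cone `P`. -/
def IsPositiveContraction (P : Set X) (T : X →L[ℝ] X) : Prop := IsPositiveOp P T ∧ ‖T‖ ≤ 1

/-- `T ≤ S` for the order with positive cone `P`. -/
def OpLe (P : Set X) (T S : X →L[ℝ] X) : Prop := IsPositiveOp P (S - T)

end Operators

end

/-!
For positive contractions `T ≤ S` on a space whose norm is additive on the positive cone,
`‖(Sᵏ - Tᵏ) x‖ = ‖Sᵏ x‖ - ‖Tᵏ x‖` for positive `x`. If `‖Sⁿ - Tⁿ‖ = d < 1` and `x` is positive of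
norm `1`, then `‖(Sⁿ⁺¹ - Tⁿ⁺¹) x‖` could be close to `1` only if `‖T x‖` were close to `0` (apply
`Sⁿ - Tⁿ` to `T x`), and also only if `‖T x‖` were bounded away from `0` (apply `Sⁿ - Tⁿ` to `x`).
Since the norm of a positive operator is determined on the cone, this gives `‖Sⁿ⁺¹ - Tⁿ⁺¹‖ < 1`,
and the result follows by induction: `norm_pow_sub_pow_lt_one`.

It remains to see that `L₁(A, τ)` is such a space. The norm is defined as the largest seminorm
dominated by `τ(|·|)`. Every `a` with `τ(|a|) < ∞` is a difference `a⁺ - a⁻` of positive elements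
with `|a| = a⁺ + a⁻`. Therefore the linear extension of `τ` to `A₁` has a dominated absolute value,
so that `‖a‖₁ = τ(a)` for positive `a`, which is additive (`PreL1.norm_add_of_isPos`); and for a
bounded operator `R` with `‖R a‖ ≤ C ‖a‖₁` for positive `a`, the seminorm `C⁻¹ ‖R ·‖` is dominated,
so that the bound holds everywhere (`PreL1.seminorm_le_of_le_on_isPos`).

What this uses of the order of a JB-algebra is that the squares form a convex cone (`IsPos.add`)
and that `|a| ± a` is positive (`isPos_modulus_add`). Both are derived without a representation
by continuous functions. If `‖1 - x‖ ≤ 1`, then a square root of `x` is found by the iteration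
`z ↦ (1 - x + z²) / 2`, which converges because it is majorized by its scalar analogue; hence on
the unit ball the positive elements are those with `‖1 - x‖ ≤ 1`. The modulus is compared with `a`
inside the closed span of the powers of `a`, which is associative by the linearized Jordan identity,
and where a sum of two squares vanishes only if both squares do.
-/

noncomputable section

open JBAlgebra

/-! ### Squares and the order cone of a JB-algebra -/

namespace JBAlgebra

variable {A : Type u} [JBAlgebra A]

instance : SMulCommClass ℝ A A where
  smul_comm r a b := by
    rw [smul_eq_mul, smul_eq_mul, mul_comm a (r • b), smul_mul_assoc, mul_comm b a]

instance : ContinuousMul A where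
  continuous_mul := by
    have h : Continuous fun p : A × A =>
        (LinearMap.mkContinuous₂ (LinearMap.mul ℝ A) 1 fun a b => by
          simpa using norm_mul_le_mul_norm a b) p.1 p.2 := by fun_prop
    exact h

lemma norm_one_le : ‖(1 : A)‖ ≤ 1 := by
  have h := norm_mul_self (1 : A)
  rw [mul_one] at h
  nlinarith [sq_nonneg (‖(1 : A)‖ - 1)]

lemma eq_zero_of_mul_self_add_mul_self_eq_zero {a b : A} (h : a * a + b * b = 0) : a = 0 := by
  have h1 := norm_mul_self_le a b
  rw [h, norm_zero, norm_mul_self] at h1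
  exact norm_eq_zero.1 (pow_eq_zero_iff two_ne_zero |>.1 (le_antisymm h1 (sq_nonneg _)))

/-- A norm-closed linear subspace that contains the unit and is closed under the Jordan product. -/
structure IsClosedSubalgebra (K : Submodule ℝ A) : Prop where
  isClosed : IsClosed (K : Set A)
  one_mem : (1 : A) ∈ K
  mul_mem : ∀ a ∈ K, ∀ b ∈ K, a * b ∈ K

/-- The iterates of `z ↦ (y + z²) / 2` starting at `0`. If `z` is their limit, then
`(1 - z)² = 1 - y`. -/
def sqrtSeq (y : A) : ℕ → A
  | 0 => 0
  | k + 1 => (1 / 2 : ℝ) • (y + sqrtSeq y k * sqrtSeq y k)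

/-- The scalar sequence that majorizes `sqrtSeq y` for all `y` in the unit ball. -/
def sqrtMajorant : ℕ → ℝ
  | 0 => 0
  | k + 1 => (1 + sqrtMajorant k ^ 2) / 2

lemma sqrtMajorant_mem (k : ℕ) : 0 ≤ sqrtMajorant k ∧ sqrtMajorant k ≤ 1 := by
  induction k with
  | zero => simp [sqrtMajorant]
  | succ k ih =>
    rw [sqrtMajorant]
    constructor <;> nlinarith

lemma norm_sqrtSeq_le {y : A} (hy : ‖y‖ ≤ 1) (k : ℕ) : ‖sqrtSeq y k‖ ≤ sqrtMajorant k := by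
  induction k with
  | zero => simp [sqrtSeq, sqrtMajorant]
  | succ k ih =>
    rw [sqrtSeq, sqrtMajorant, norm_smul, Real.norm_of_nonneg (by norm_num)]
    have h1 := norm_add_le y (sqrtSeq y k * sqrtSeq y k)
    rw [norm_mul_self] at h1
    nlinarith [norm_nonneg (sqrtSeq y k)]

lemma norm_sqrtSeq_succ_sub_le {y : A} (hy : ‖y‖ ≤ 1) (k : ℕ) :
    ‖sqrtSeq y (k + 1) - sqrtSeq y k‖ ≤ sqrtMajorant (k + 1) - sqrtMajorant k := by
  induction k with
  | zero =>
    simp only [sqrtSeq, sqrtMajorant, norm_smul, mul_zero, add_zero, sub_zero]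
    rw [Real.norm_of_nonneg (by norm_num)]
    linarith
  | succ k ih =>
    have h : sqrtSeq y (k + 2) - sqrtSeq y (k + 1) = (1 / 2 : ℝ) •
        ((sqrtSeq y (k + 1) - sqrtSeq y k) * (sqrtSeq y (k + 1) + sqrtSeq y k)) := by
      rw [sqrtSeq, sub_mul, mul_add, mul_add, mul_comm (sqrtSeq y k) (sqrtSeq y (k + 1))]
      conv_lhs => rw [sub_eq_add_neg]; arg 2; rw [sqrtSeq]
      module
    have h1 := norm_mul_le_mul_norm (sqrtSeq y (k + 1) - sqrtSeq y k)
      (sqrtSeq y (k + 1) + sqrtSeq y k)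
    have h2 := (norm_add_le (sqrtSeq y (k + 1)) (sqrtSeq y k)).trans
      (add_le_add (norm_sqrtSeq_le hy (k + 1)) (norm_sqrtSeq_le hy k))
    have h3 := mul_le_mul ih h2 (norm_nonneg _) ((norm_nonneg _).trans ih)
    have h4 : sqrtMajorant (k + 2) = (1 + sqrtMajorant (k + 1) ^ 2) / 2 := rfl
    have h5 : sqrtMajorant (k + 1) = (1 + sqrtMajorant k ^ 2) / 2 := rfl
    rw [h, norm_smul, Real.norm_of_nonneg (by norm_num), h4]
    nlinarith

/-- An element at distance at most `1` from the unit is a square. The root that is found is again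
at distance at most `1` from the unit, and is a limit of polynomials in the given element. -/
lemma exists_mul_self_eq_of_norm_one_sub_le {x : A} (hx : ‖1 - x‖ ≤ 1) :
    ∃ b : A, b * b = x ∧ ‖1 - b‖ ≤ 1 ∧
      ∀ K : Submodule ℝ A, IsClosedSubalgebra K → x ∈ K → b ∈ K := by
  have hcau : CauchySeq (sqrtSeq (1 - x)) := by
    refine cauchySeq_of_dist_le_of_summable (fun k => sqrtMajorant (k + 1) - sqrtMajorant k)
      (fun k => ?_) ?_
    · rw [dist_comm, dist_eq_norm]
      exact norm_sqrtSeq_succ_sub_le hx k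
    · refine summable_of_sum_range_le (c := 1)
        (fun k => (norm_nonneg _).trans (norm_sqrtSeq_succ_sub_le hx k)) fun n => ?_
      rw [Finset.sum_range_sub]
      simpa [sqrtMajorant] using (sqrtMajorant_mem n).2
  obtain ⟨z, hz⟩ := cauchySeq_tendsto_of_complete hcau
  have hfix : z = (1 / 2 : ℝ) • (1 - x + z * z) :=
    tendsto_nhds_unique (hz.comp (Filter.tendsto_add_atTop_nat 1))
      (((hz.mul hz).const_add (1 - x)).const_smul (1 / 2 : ℝ))
  refine ⟨1 - z, ?_, ?_, fun K hK hxK => ?_⟩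
  · have h2 : (2 : ℝ) • z = 1 - x + z * z := by
      conv_lhs => rw [hfix, smul_smul]
      norm_num
    rw [two_smul] at h2
    calc (1 - z) * (1 - z) = 1 - (z + z) + z * z := by
          rw [sub_mul, one_mul, mul_sub, mul_one]; abel
      _ = x := by rw [h2]; abel
  · rw [sub_sub_cancel]
    exact le_of_tendsto hz.norm (Filter.Eventually.of_forall fun k =>
      (norm_sqrtSeq_le hx k).trans (sqrtMajorant_mem k).2)
  · refine K.sub_mem hK.one_mem (hK.isClosed.mem_of_tendsto hz (Filter.Eventually.of_forall ?_))
    intro k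
    induction k with
    | zero => exact K.zero_mem
    | succ k ih =>
      exact K.smul_mem _ (K.add_mem (K.sub_mem hK.one_mem hxK) (hK.mul_mem _ ih _ ih))

lemma isPos_of_norm_one_sub_le {x : A} (hx : ‖1 - x‖ ≤ 1) : IsPos x := by
  obtain ⟨b, hb, -⟩ := exists_mul_self_eq_of_norm_one_sub_le hx
  exact ⟨b, hb.symm⟩

/-- If `‖b²‖ ≤ 1`, then `1 - b²` is a square `c²`, so that `‖c²‖ ≤ ‖c² + b²‖ = ‖1‖`. -/
lemma IsPos.norm_one_sub_le {x : A} (hx : IsPos x) (h1 : ‖x‖ ≤ 1) : ‖1 - x‖ ≤ 1 := by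
  obtain ⟨b, rfl⟩ := hx
  obtain ⟨c, hc⟩ : IsPos (1 - b * b) := isPos_of_norm_one_sub_le (by rwa [sub_sub_cancel])
  have h := norm_mul_self_le c b
  rw [← hc, sub_add_cancel] at h
  exact h.trans norm_one_le

lemma isPos_zero : IsPos (0 : A) := ⟨0, by simp⟩

lemma IsPos.smul {x : A} (hx : IsPos x) {r : ℝ} (hr : 0 ≤ r) : IsPos (r • x) := by
  obtain ⟨b, rfl⟩ := hx
  refine ⟨√r • b, ?_⟩
  rw [smul_mul_smul_comm, Real.mul_self_sqrt hr]

lemma IsPos.of_smul {x : A} {r : ℝ} (hr : 0 < r) (hx : IsPos (r • x)) : IsPos x := by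
  have h := hx.smul (inv_nonneg.2 hr.le)
  rwa [smul_smul, inv_mul_cancel₀ hr.ne', one_smul] at h

/-- The cone of squares is convex: on the unit ball it is the set `‖1 - x‖ ≤ 1`. -/
lemma IsPos.add {x y : A} (hx : IsPos x) (hy : IsPos y) : IsPos (x + y) := by
  obtain ⟨r, hr, hrx, hry⟩ : ∃ r : ℝ, 0 < r ∧ r * ‖x‖ ≤ 1 ∧ r * ‖y‖ ≤ 1 := by
    have h0 : 0 < 1 + ‖x‖ + ‖y‖ := by positivity
    refine ⟨(1 + ‖x‖ + ‖y‖)⁻¹, by positivity, ?_, ?_⟩ <;>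
      rw [inv_mul_le_one₀ h0] <;> linarith [norm_nonneg x, norm_nonneg y]
  have key : ∀ z : A, IsPos z → r * ‖z‖ ≤ 1 → ‖1 - r • z‖ ≤ 1 := fun z hz hrz =>
    (hz.smul hr.le).norm_one_sub_le (by rwa [norm_smul, Real.norm_of_nonneg hr.le])
  refine IsPos.of_smul (r := r / 2) (by positivity) (isPos_of_norm_one_sub_le ?_)
  have h : (1 : A) - (r / 2) • (x + y) =
      (1 / 2 : ℝ) • ((1 - r • x) + (1 - r • y)) := by module
  rw [h, norm_smul, Real.norm_of_nonneg (by norm_num)]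
  linarith [norm_add_le (1 - r • x) (1 - r • y), key x hx hrx, key y hy hry]

/-- A positive element has a positive square root which is a limit of polynomials in it. -/
lemma IsPos.exists_sqrt {x : A} (hx : IsPos x) :
    ∃ b : A, b * b = x ∧ IsPos b ∧
      ∀ K : Submodule ℝ A, IsClosedSubalgebra K → x ∈ K → b ∈ K := by
  have hr : 0 < ‖x‖ + 1 := by positivity
  obtain ⟨b, hb, hb1, hbK⟩ := exists_mul_self_eq_of_norm_one_sub_le
    ((hx.smul (inv_nonneg.2 hr.le)).norm_one_sub_le (by
      rw [norm_smul, Real.norm_of_nonneg (inv_nonneg.2 hr.le), inv_mul_le_one₀ hr]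
      linarith))
  refine ⟨√(‖x‖ + 1) • b, ?_, (isPos_of_norm_one_sub_le hb1).smul (Real.sqrt_nonneg _),
    fun K hK hxK => K.smul_mem _ (hbK K hK (K.smul_mem _ hxK))⟩
  rw [smul_mul_smul_comm, Real.mul_self_sqrt hr.le, hb, smul_smul, mul_inv_cancel₀ hr.ne',
    one_smul]

end JBAlgebra

/-! ### Power associativity and the modulus -/

namespace JBAlgebra

section Powers

variable {A : Type u} [JBAlgebra A]

/-- The powers with `a⁰ = 1` and `aⁿ⁺¹ = a ∘ aⁿ`. The algebra is not associative, so that it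
carries no `Monoid` structure. -/
def jpow (a : A) : ℕ → A
  | 0 => 1
  | n + 1 => a * jpow a n

attribute [local instance 100] LieRing.ofAssociativeRing in
/-- The linearized Jordan identity. -/
lemma linearized_jordan (a b c x : A) :
    a * ((b * c) * x) + b * ((c * a) * x) + c * ((a * b) * x) =
      (b * c) * (a * x) + (c * a) * (b * x) + (a * b) * (c * x) := by
  have h := DFunLike.congr_fun (two_nsmul_lie_lmul_lmul_add_add_eq_zero a b c) x
  have h' : (2 : ℝ) • ((a * ((b * c) * x) - (b * c) * (a * x)) +
      (b * ((c * a) * x) - (c * a) * (b * x)) +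
      (c * ((a * b) * x) - (a * b) * (c * x))) = 0 := by
    refine Eq.trans ?_ h
    rw [two_smul, two_nsmul]
    rfl
  have h'' := (smul_eq_zero.1 h').resolve_left two_ne_zero
  rw [← sub_eq_zero, ← h'']
  abel

/-- Multiplication by `a ∘ (a ∘ b)` is a polynomial in the multiplications by `a`, `b`, `a ∘ a`
and `a ∘ b`. -/
lemma mul_mul_mul_eq (a b x : A) :
    (a * (a * b)) * x = (a * b) * (a * x) + (a * b) * (a * x) + (a * a) * (b * x) -
      b * (a * (a * x)) - a * (a * (b * x)) := by
  have h : b * (a * (a * x)) + a * (a * (b * x)) + a * (a * b) * x =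
      (a * b) * (a * x) + (a * a) * (b * x) + (a * b) * (a * x) := by
    simpa only [mul_comm] using linearized_jordan b a x a
  rw [← sub_eq_zero, ← sub_eq_zero.2 h]
  abel

/-- Multiplications by `a` and by its powers commute. -/
lemma mul_jpow_mul (a : A) (n : ℕ) (x : A) : a * (jpow a n * x) = jpow a n * (a * x) := by
  suffices h : ∀ n, (∀ x, a * (jpow a n * x) = jpow a n * (a * x)) ∧
      ∀ x, a * (jpow a (n + 1) * x) = jpow a (n + 1) * (a * x) from (h n).1 x
  intro n
  induction n with
  | zero => simp [jpow]
  | succ n ih =>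
    refine ⟨ih.2, fun x => ?_⟩
    obtain ⟨h0, h1⟩ := ih
    have h1' : ∀ x, a * ((a * jpow a n) * x) = (a * jpow a n) * (a * x) := h1
    have h2 : ∀ x, a * ((a * a) * x) = (a * a) * (a * x) := fun x =>
      (IsJordan.lmul_lmul_comm_lmul a x).symm
    simp only [jpow, mul_mul_mul_eq, mul_add, mul_sub, h1', h2, h0]

lemma jpow_mul_jpow (a : A) (m n : ℕ) : jpow a m * jpow a n = jpow a (m + n) := by
  induction n with
  | zero => simp [jpow]
  | succ n ih => rw [jpow, ← mul_jpow_mul, ih, ← add_assoc, jpow]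

/-- Every element lies in a closed subalgebra which is associative, namely the closed span of
its powers. -/
lemma exists_assoc_subalgebra (a : A) : ∃ K : Submodule ℝ A, IsClosedSubalgebra K ∧ a ∈ K ∧
    ∀ x ∈ K, ∀ y ∈ K, ∀ z ∈ K, x * y * z = x * (y * z) := by
  set P : Submodule ℝ A := Submodule.span ℝ (Set.range (jpow a)) with hP
  have hmem : ∀ n, jpow a n ∈ P := fun n => Submodule.subset_span ⟨n, rfl⟩
  have hmul : ∀ x ∈ P, ∀ y ∈ P, x * y ∈ P := by
    intro x hx y hy
    induction hx, hy using Submodule.span_induction₂ with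
    | mem_mem x y hx hy =>
      obtain ⟨⟨m, rfl⟩, ⟨n, rfl⟩⟩ := And.intro hx hy
      rw [jpow_mul_jpow]
      exact hmem _
    | zero_left y hy => simp
    | zero_right x hx => simp
    | add_left x y z _ _ _ h1 h2 => rw [add_mul]; exact P.add_mem h1 h2
    | add_right x y z _ _ _ h1 h2 => rw [mul_add]; exact P.add_mem h1 h2
    | smul_left r x y _ _ h => rw [smul_mul_assoc]; exact P.smul_mem r h
    | smul_right r x y _ _ h => rw [mul_smul_comm]; exact P.smul_mem r h
  have hassoc : ∀ x ∈ P, ∀ y ∈ P, ∀ z ∈ P, x * y * z = x * (y * z) := by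
    intro x hx y hy z hz
    induction hz using Submodule.span_induction with
    | mem z hz =>
      obtain ⟨k, rfl⟩ := hz
      induction hx, hy using Submodule.span_induction₂ with
      | mem_mem x y hx hy =>
        obtain ⟨⟨m, rfl⟩, ⟨n, rfl⟩⟩ := And.intro hx hy
        simp only [jpow_mul_jpow, add_assoc]
      | zero_left y hy => simp
      | zero_right x hx => simp
      | add_left x y z _ _ _ h1 h2 => simp only [add_mul, h1, h2]
      | add_right x y z _ _ _ h1 h2 => simp only [add_mul, mul_add, h1, h2]
      | smul_left r x y _ _ h => simp only [smul_mul_assoc, h]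
      | smul_right r x y _ _ h => simp only [smul_mul_assoc, mul_smul_comm, h]
    | zero => simp
    | add z w _ _ h1 h2 => simp only [mul_add, h1, h2]
    | smul r z _ h => simp only [mul_smul_comm, h]
  refine ⟨P.topologicalClosure, ⟨P.isClosed_topologicalClosure, ?_, ?_⟩, ?_, ?_⟩
  · exact P.le_topologicalClosure (hmem 0)
  · exact fun x hx y hy => map_mem_closure₂ continuous_mul hx hy hmul
  · exact P.le_topologicalClosure (by simpa [jpow] using hmem 1)
  · intro x hx y hy z hz
    have h1 : ∀ x ∈ P.topologicalClosure, ∀ y ∈ P, ∀ z ∈ P, x * y * z = x * (y * z) :=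
      fun x hx y hy z hz => closure_minimal (fun x hx => hassoc x hx y hy z hz)
        (isClosed_eq (by fun_prop : Continuous fun x => x * y * z) (by fun_prop)) hx
    have h2 : ∀ x ∈ P.topologicalClosure, ∀ y ∈ P.topologicalClosure, ∀ z ∈ P,
        x * y * z = x * (y * z) :=
      fun x hx y hy z hz => closure_minimal (fun y hy => h1 x hx y hy z hz)
        (isClosed_eq (by fun_prop : Continuous fun y => x * y * z) (by fun_prop)) hy
    exact closure_minimal (fun z hz => h2 x hx y hy z hz)
      (isClosed_eq (by fun_prop : Continuous fun z => x * y * z) (by fun_prop)) hz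

/-- An associative subalgebra as a commutative ring. -/
abbrev IsClosedSubalgebra.commRing {K : Submodule ℝ A} (hK : IsClosedSubalgebra K)
    (h : ∀ x ∈ K, ∀ y ∈ K, ∀ z ∈ K, x * y * z = x * (y * z)) : CommRing K where
  __ := (inferInstance : AddCommGroup K)
  mul x y := ⟨x.1 * y.1, hK.mul_mem _ x.2 _ y.2⟩
  one := ⟨1, hK.one_mem⟩
  mul_assoc x y z := Subtype.ext (h _ x.2 _ y.2 _ z.2)
  mul_comm x y := Subtype.ext (mul_comm x.1 y.1)
  one_mul x := Subtype.ext (one_mul x.1)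
  mul_one x := Subtype.ext (mul_one x.1)
  zero_mul x := Subtype.ext (zero_mul x.1)
  mul_zero x := Subtype.ext (mul_zero x.1)
  left_distrib x y z := Subtype.ext (mul_add x.1 y.1 z.1)
  right_distrib x y z := Subtype.ext (add_mul x.1 y.1 z.1)

end Powers

section RealRing

variable {R : Type*} [CommRing R]

/-- In a commutative ring where a sum of two squares vanishes only trivially, two squares with
equal squares are equal. -/
lemma eq_of_sq_eq_of_real (hR : ∀ x y : R, x * x + y * y = 0 → x = 0) {c d : R}
    (h : c * c * (c * c) = d * d * (d * d)) : c * c = d * d := by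
  set n := c * c - d * d with hn
  have h0 : (c * n) * (c * n) + (d * n) * (d * n) = 0 := by
    rw [hn]; linear_combination (c * c - d * d) * h
  have hc := hR _ _ h0
  have hd := hR _ _ ((add_comm _ _).trans h0)
  refine sub_eq_zero.1 (hR n 0 ?_)
  linear_combination c * hc - d * hd + n * hn

/-- In a commutative ring where a sum of two squares vanishes only trivially: if `u v = 0` and
`u + v` is a square, then `u` is equal to each square `e²` with `(e²)² = u²`. -/
lemma eq_of_mul_eq_zero_of_real (hR : ∀ x y : R, x * x + y * y = 0 → x = 0) {u v d e : R}
    (huv : u * v = 0) (hd : u + v = d * d) (he : e * e * (e * e) = u * u) : u = e * e := by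
  have hpv : e * e * v = 0 := hR _ 0 (by linear_combination v * v * he + u * v * huv)
  set n := e * e - u with hn
  have h0 : (e * n) * (e * n) + (d * n) * (d * n) = 0 := by
    linear_combination (-n * n) * hd + n * (hpv - huv) + n * he
  have hen := hR _ _ h0
  have hdn := hR _ _ ((add_comm _ _).trans h0)
  refine (sub_eq_zero.1 (hR n 0 ?_)).symm
  linear_combination e * hen - n * hd - d * hdn + (hpv - huv)

end RealRing

variable {A : Type u} [JBAlgebra A]

/-- Uniqueness of positive square roots. -/
lemma IsPos.eq_of_mul_self_eq {a b : A} (ha : IsPos a) (hb : IsPos b) (h : a * a = b * b) :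
    a = b := by
  -- It suffices to compare `a` with the root `w` of `a²` that lies in each closed subalgebra
  -- containing `a²`; the same `w` serves for `b`.
  obtain ⟨w, hw, hwpos, hwK⟩ := IsPos.exists_sqrt (⟨a, rfl⟩ : IsPos (a * a))
  have key : ∀ m : A, IsPos m → m * m = a * a → m = w := by
    intro m hm hma
    obtain ⟨K, hK, hmK, hassoc⟩ := exists_assoc_subalgebra m
    have hwK' : w ∈ K := hwK K hK (hma ▸ hK.mul_mem m hmK m hmK)
    obtain ⟨c, hc, -, hcK⟩ := hm.exists_sqrt
    obtain ⟨d, hd, -, hdK⟩ := hwpos.exists_sqrt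
    let _ := hK.commRing hassoc
    have hcd := eq_of_sq_eq_of_real (R := K)
      (fun x y hxy => Subtype.ext
        (eq_zero_of_mul_self_add_mul_self_eq_zero (congrArg Subtype.val hxy)))
      (c := ⟨c, hcK K hK hmK⟩) (d := ⟨d, hdK K hK hwK'⟩)
      (Subtype.ext (show c * c * (c * c) = d * d * (d * d) by rw [hc, hd, hma, hw]))
    rw [← hc, ← hd]
    exact congrArg Subtype.val hcd
  rw [key a ha rfl, key b hb h.symm]

lemma modulus_spec (a : A) : IsPos (modulus a) ∧ modulus a * modulus a = a * a := by
  obtain ⟨w, hw, hwpos, -⟩ := IsPos.exists_sqrt (⟨a, rfl⟩ : IsPos (a * a))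
  exact Classical.epsilon_spec (p := fun b : A => IsPos b ∧ b * b = a * a) ⟨w, hwpos, hw⟩

lemma IsPos.modulus_eq {a : A} (ha : IsPos a) : modulus a = a :=
  (modulus_spec a).1.eq_of_mul_self_eq ha (modulus_spec a).2

lemma modulus_neg (a : A) : modulus (-a) = modulus a :=
  (modulus_spec (-a)).1.eq_of_mul_self_eq (modulus_spec a).1 (by
    rw [(modulus_spec (-a)).2, (modulus_spec a).2, neg_mul_neg])

lemma isPos_modulus_add (a : A) : IsPos (modulus a + a) := by
  obtain ⟨K, hK, haK, hassoc⟩ := exists_assoc_subalgebra a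
  obtain ⟨w, hw, hwpos, hwK⟩ := IsPos.exists_sqrt (⟨a, rfl⟩ : IsPos (a * a))
  have hwK' : w ∈ K := hwK K hK (hK.mul_mem a haK a haK)
  rw [(modulus_spec a).1.eq_of_mul_self_eq hwpos ((modulus_spec a).2.trans hw.symm)]
  obtain ⟨d, hd, -, hdK⟩ := (hwpos.add hwpos).exists_sqrt
  -- `p` is the modulus of `w + a`; as `w + a` and `w - a` have zero product and positive sum,
  -- it is equal to `w + a`.
  obtain ⟨p, hp, hppos, hpK⟩ := IsPos.exists_sqrt (⟨w + a, rfl⟩ : IsPos ((w + a) * (w + a)))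
  have hpK' : p ∈ K := hpK K hK (hK.mul_mem _ (K.add_mem hwK' haK) _ (K.add_mem hwK' haK))
  obtain ⟨e, he, -, heK⟩ := hppos.exists_sqrt
  let _ := hK.commRing hassoc
  have h := eq_of_mul_eq_zero_of_real (R := K)
      (fun x y hxy => Subtype.ext
        (eq_zero_of_mul_self_add_mul_self_eq_zero (congrArg Subtype.val hxy)))
      (u := ⟨w + a, K.add_mem hwK' haK⟩) (v := ⟨w - a, K.sub_mem hwK' haK⟩)
      (d := ⟨d, hdK K hK (K.add_mem hwK' hwK')⟩) (e := ⟨e, heK K hK hpK'⟩)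
      (Subtype.ext (show (w + a) * (w - a) = 0 by
        rw [add_mul, mul_sub, mul_sub, hw, mul_comm a w]; abel))
      (Subtype.ext (show w + a + (w - a) = d * d by rw [hd]; abel))
      (Subtype.ext (show e * e * (e * e) = (w + a) * (w + a) by rw [he, hp]))
  exact ⟨e, congrArg Subtype.val h⟩

lemma isPos_modulus_sub (a : A) : IsPos (modulus a - a) := by
  simpa [modulus_neg, ← sub_eq_add_neg] using isPos_modulus_add (-a)

end JBAlgebra

/-! ### The norm of `L₁(A, τ)` on its positive cone -/

section TraceNorm

variable {A : Type u} [JBAlgebra A] (τ : FNSTrace A)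

namespace FNSTrace

lemma map_add {a b : A} (ha : IsPos a) (hb : IsPos b) :
    τ.toFun (a + b) = τ.toFun a + τ.toFun b := by
  simpa using τ.map_add_smul a b ha hb 1

/-- The value `∞` at `0` is excluded only by semi-finiteness. -/
lemma map_zero : τ.toFun 0 = 0 := by
  obtain ⟨D, hD, ⟨d, hd⟩, -, -, hfin⟩ := τ.semifinite
  have h := τ.map_add (hD d hd) isPos_zero
  exact (ENNReal.add_right_inj (hfin d hd).ne).1 (h.symm.trans (by simp))

lemma map_smul {a : A} (ha : IsPos a) {r : ℝ} (hr : 0 ≤ r) :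
    τ.toFun (r • a) = ENNReal.ofReal r * τ.toFun a := by
  have h := τ.map_add_smul 0 a isPos_zero ha ⟨r, hr⟩
  rw [zero_add, map_zero, zero_add] at h
  rw [ENNReal.ofReal_eq_coe_nnreal hr]
  exact h

/-- `a = p - q` with `p` and `q` positive and of finite trace. -/
structure IsDecomp (a p q : A) : Prop where
  left : IsPos p
  right : IsPos q
  left_lt : τ.toFun p < ∞
  right_lt : τ.toFun q < ∞
  eq : a = p - q

variable {τ} in
lemma IsDecomp.add {a p q a' p' q' : A} (h : τ.IsDecomp a p q) (h' : τ.IsDecomp a' p' q') :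
    τ.IsDecomp (a + a') (p + p') (q + q') where
  left := h.left.add h'.left
  right := h.right.add h'.right
  left_lt := by
    rw [τ.map_add h.left h'.left]; exact ENNReal.add_lt_top.2 ⟨h.left_lt, h'.left_lt⟩
  right_lt := by
    rw [τ.map_add h.right h'.right]; exact ENNReal.add_lt_top.2 ⟨h.right_lt, h'.right_lt⟩
  eq := by rw [h.eq, h'.eq]; abel

variable {τ} in
lemma IsDecomp.smul {a p q : A} (h : τ.IsDecomp a p q) {r : ℝ} (hr : 0 ≤ r) :
    τ.IsDecomp (r • a) (r • p) (r • q) where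
  left := h.left.smul hr
  right := h.right.smul hr
  left_lt := by
    rw [τ.map_smul h.left hr]; exact ENNReal.mul_lt_top ENNReal.ofReal_lt_top h.left_lt
  right_lt := by
    rw [τ.map_smul h.right hr]; exact ENNReal.mul_lt_top ENNReal.ofReal_lt_top h.right_lt
  eq := by rw [h.eq, smul_sub]

variable {τ} in
lemma IsDecomp.neg {a p q : A} (h : τ.IsDecomp a p q) : τ.IsDecomp (-a) q p where
  left := h.right
  right := h.left
  left_lt := h.right_lt
  right_lt := h.left_lt
  eq := by rw [h.eq]; abel

variable {τ} in
lemma IsDecomp.toReal_sub_toReal_eq {a p q p' q' : A} (h : τ.IsDecomp a p q) (h' : τ.IsDecomp a p' q') :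
    (τ.toFun p).toReal - (τ.toFun q).toReal = (τ.toFun p').toReal - (τ.toFun q').toReal := by
  have h1 : p + q' = p' + q := by
    have := h.eq.symm.trans h'.eq
    rw [sub_eq_sub_iff_add_eq_add] at this
    exact this
  have h2 := congrArg (fun x => (τ.toFun x).toReal) h1
  simp only [τ.map_add h.left h'.right, τ.map_add h'.left h.right] at h2
  rw [ENNReal.toReal_add h.left_lt.ne h'.right_lt.ne,
    ENNReal.toReal_add h'.left_lt.ne h.right_lt.ne] at h2
  linarith

/-- `a = a⁺ - a⁻` with `|a| = a⁺ + a⁻`. -/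
lemma exists_isDecomp_of_absTrace_lt {a : A} (h : τ.absTrace a < ∞) :
    ∃ p q, τ.IsDecomp a p q ∧ τ.absTrace a = τ.toFun p + τ.toFun q := by
  set p : A := (1 / 2 : ℝ) • (modulus a + a) with hp
  set q : A := (1 / 2 : ℝ) • (modulus a - a) with hq
  have hpp : IsPos p := (isPos_modulus_add a).smul (by norm_num)
  have hqp : IsPos q := (isPos_modulus_sub a).smul (by norm_num)
  have hsum : τ.absTrace a = τ.toFun p + τ.toFun q := by
    rw [← τ.map_add hpp hqp, absTrace]
    congr 1
    module
  rw [hsum, ENNReal.add_lt_top] at h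
  exact ⟨p, q, ⟨hpp, hqp, h.1, h.2, by module⟩, hsum⟩

lemma exists_isDecomp (a : PreL1 τ) : ∃ p q, τ.IsDecomp a.val p q := by
  obtain ⟨x, hx⟩ := a
  change ∃ p q, τ.IsDecomp x p q
  change x ∈ Submodule.span ℝ _ at hx
  induction hx using Submodule.span_induction with
  | mem x hx =>
    obtain ⟨p, q, h, -⟩ := τ.exists_isDecomp_of_absTrace_lt hx
    exact ⟨p, q, h⟩
  | zero =>
    have h0 : τ.toFun 0 < ∞ := by rw [map_zero]; exact ENNReal.zero_lt_top
    exact ⟨0, 0, isPos_zero, isPos_zero, h0, h0, by simp⟩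
  | add x y _ _ hx hy =>
    obtain ⟨p, q, h⟩ := hx
    obtain ⟨p', q', h'⟩ := hy
    exact ⟨_, _, h.add h'⟩
  | smul r x _ hx =>
    obtain ⟨p, q, h⟩ := hx
    rcases le_total 0 r with hr | hr
    · exact ⟨_, _, h.smul hr⟩
    · have h' := (h.smul (neg_nonneg.2 hr)).neg
      rw [neg_smul, neg_neg] at h'
      exact ⟨_, _, h'⟩

/-- The linear extension of `τ` to `A₁`. -/
lemma exists_linear_extension : ∃ f : PreL1 τ →ₗ[ℝ] ℝ, ∀ (a : PreL1 τ) (p q : A),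
    τ.IsDecomp a.val p q → f a = (τ.toFun p).toReal - (τ.toFun q).toReal := by
  choose p q h using τ.exists_isDecomp
  refine ⟨{ toFun := fun a => (τ.toFun (p a)).toReal - (τ.toFun (q a)).toReal
            map_add' := fun a b => ?_
            map_smul' := fun r a => ?_ }, fun a p' q' h' => (h a).toReal_sub_toReal_eq h'⟩
  · have hab := (h a).add (h b)
    rw [← _root_.map_add] at hab
    rw [(h (a + b)).toReal_sub_toReal_eq hab, τ.map_add (h a).left (h b).left,
      τ.map_add (h a).right (h b).right, ENNReal.toReal_add (h a).left_lt.ne (h b).left_lt.ne,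
      ENNReal.toReal_add (h a).right_lt.ne (h b).right_lt.ne]
    ring
  · rcases le_total 0 r with hr | hr
    · have hra := (h a).smul hr
      rw [← _root_.map_smul] at hra
      rw [(h (r • a)).toReal_sub_toReal_eq hra, τ.map_smul (h a).left hr, τ.map_smul (h a).right hr,
        ENNReal.toReal_mul, ENNReal.toReal_mul, ENNReal.toReal_ofReal hr, RingHom.id_apply,
        smul_eq_mul]
      ring
    · have hr' := neg_nonneg.2 hr
      have hra := ((h a).smul hr').neg
      rw [neg_smul, neg_neg, ← _root_.map_smul] at hra
      rw [(h (r • a)).toReal_sub_toReal_eq hra, τ.map_smul (h a).left hr', τ.map_smul (h a).right hr',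
        ENNReal.toReal_mul, ENNReal.toReal_mul, ENNReal.toReal_ofReal hr', RingHom.id_apply,
        smul_eq_mul]
      ring

end FNSTrace

namespace PreL1

variable {τ}

lemma exists_val_eq {x : A} (hx : τ.absTrace x < ∞) : ∃ y : PreL1 τ, y.val = x :=
  ⟨(⟨x, Submodule.subset_span hx⟩ : τ.A1), rfl⟩

lemma norm_def (a : PreL1 τ) : ‖a‖ = l1Seminorm τ a := rfl

lemma le_norm_of_mem {p : Seminorm ℝ (PreL1 τ)} (hp : p ∈ dominatedSeminorms τ) (a : PreL1 τ) :
    p a ≤ ‖a‖ :=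
  le_csSup (bddAbove_dominatedSeminorms τ) hp a

lemma ofReal_norm_le (a : PreL1 τ) : ENNReal.ofReal ‖a‖ ≤ τ.absTrace a.val := by
  rcases eq_or_ne (τ.absTrace a.val) ∞ with h | h
  · rw [h]
    exact le_top
  rw [ENNReal.ofReal_le_iff_le_toReal h, norm_def, l1Seminorm,
    Seminorm.sSup_apply (bddAbove_dominatedSeminorms τ)]
  exact Real.iSup_le (fun p => (ENNReal.ofReal_le_iff_le_toReal h).1 (p.2 a))
    ENNReal.toReal_nonneg

/-- A positive element of `A₁` is a difference of positive elements of finite trace, by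
definition of `A₁` as a span; the lower bound for its norm comes from the linear extension
of the trace. -/
lemma norm_eq_of_linear_extension {f : PreL1 τ →ₗ[ℝ] ℝ}
    (hf : ∀ (a : PreL1 τ) (p q : A), τ.IsDecomp a.val p q →
      f a = (τ.toFun p).toReal - (τ.toFun q).toReal)
    {a : PreL1 τ} (ha : IsPos a.val) : ‖a‖ = f a := by
  -- A positive element of `A₁` has finite trace.
  obtain ⟨p, q, hpq⟩ := τ.exists_isDecomp a
  have hfin : τ.toFun a.val < ∞ := by
    refine lt_of_le_of_lt ?_ hpq.left_lt
    have h := τ.map_add ha hpq.right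
    rw [hpq.eq, sub_add_cancel] at h
    rw [hpq.eq, h]
    exact le_self_add
  have h0 : τ.toFun 0 = 0 := τ.map_zero
  have hfa : f a = (τ.toFun a.val).toReal := by
    rw [hf a a.val 0 ⟨ha, isPos_zero, hfin, by simp [h0], by simp⟩, h0]
    simp
  refine le_antisymm ?_ ?_
  · have h := ofReal_norm_le a
    rw [FNSTrace.absTrace, ha.modulus_eq] at h
    rw [hfa]
    exact (ENNReal.ofReal_le_iff_le_toReal hfin.ne).1 h
  · have hmem : f.toSeminorm ∈ dominatedSeminorms τ := by
      intro b
      rcases eq_or_ne (τ.absTrace b.val) ∞ with h | h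
      · simp [h]
      obtain ⟨p, q, hpq, habs⟩ := τ.exists_isDecomp_of_absTrace_lt h.lt_top
      rw [habs, ENNReal.ofReal_le_iff_le_toReal
        (ENNReal.add_ne_top.2 ⟨hpq.left_lt.ne, hpq.right_lt.ne⟩),
        ENNReal.toReal_add hpq.left_lt.ne hpq.right_lt.ne, LinearMap.toSeminorm_apply,
        hf b p q hpq, Real.norm_eq_abs, abs_le]
      have h1 : 0 ≤ (τ.toFun p).toReal := ENNReal.toReal_nonneg
      have h2 : 0 ≤ (τ.toFun q).toReal := ENNReal.toReal_nonneg
      constructor <;> linarith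
    exact (le_abs_self _).trans (le_norm_of_mem hmem a)

lemma norm_add_of_isPos {a b : PreL1 τ} (ha : IsPos a.val) (hb : IsPos b.val) :
    ‖a + b‖ = ‖a‖ + ‖b‖ := by
  obtain ⟨f, hf⟩ := τ.exists_linear_extension
  rw [norm_eq_of_linear_extension hf ha, norm_eq_of_linear_extension hf hb,
    norm_eq_of_linear_extension hf (by rw [map_add]; exact ha.add hb), map_add]

/-- A seminorm bounded by `C ‖·‖` on positive elements is bounded by `C ‖·‖` on `A₁`: it is
bounded by `C τ(|·|)`, because of `|a| = a⁺ + a⁻`. -/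
lemma seminorm_le_of_le_on_isPos (p : Seminorm ℝ (PreL1 τ)) {C : ℝ} (hC : 0 < C)
    (h : ∀ a : PreL1 τ, IsPos a.val → p a ≤ C * ‖a‖) (a : PreL1 τ) : p a ≤ C * ‖a‖ := by
  have key : ∀ x : A, IsPos x → τ.toFun x < ∞ →
      ∃ y : PreL1 τ, y.val = x ∧ p y ≤ C * (τ.toFun x).toReal := by
    intro x hx hfin
    have habs : τ.absTrace x = τ.toFun x := by rw [FNSTrace.absTrace, hx.modulus_eq]
    obtain ⟨y, rfl⟩ := exists_val_eq (habs.trans_lt hfin)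
    refine ⟨y, rfl, (h y hx).trans ?_⟩
    gcongr
    exact (ENNReal.ofReal_le_iff_le_toReal hfin.ne).1 ((ofReal_norm_le y).trans_eq habs)
  obtain ⟨r, hr⟩ : ∃ r : ℝ≥0, (r : ℝ) = C⁻¹ := ⟨⟨C⁻¹, inv_nonneg.2 hC.le⟩, rfl⟩
  have hmem : r • p ∈ dominatedSeminorms τ := by
    intro b
    rcases eq_or_ne (τ.absTrace b.val) ∞ with hb | hb
    · simp [hb]
    obtain ⟨x, y, hxy, habs⟩ := τ.exists_isDecomp_of_absTrace_lt hb.lt_top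
    obtain ⟨x', hx', hpx⟩ := key x hxy.left hxy.left_lt
    obtain ⟨y', hy', hpy⟩ := key y hxy.right hxy.right_lt
    have hb' : b = x' - y' := by
      refine Subtype.val_injective ?_
      change b.val = (x' - y').val
      rw [map_sub, hx', hy', hxy.eq]
    rw [habs, ENNReal.ofReal_le_iff_le_toReal
        (ENNReal.add_ne_top.2 ⟨hxy.left_lt.ne, hxy.right_lt.ne⟩),
        ENNReal.toReal_add hxy.left_lt.ne hxy.right_lt.ne]
    change (r : ℝ) * p b ≤ _
    rw [hr, inv_mul_le_iff₀ hC, hb']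
    linarith [map_sub_le_add p x' y']
  have h1 : (r : ℝ) * p a ≤ ‖a‖ := le_norm_of_mem hmem a
  rwa [hr, inv_mul_le_iff₀ hC] at h1

end PreL1

namespace L1

variable {τ}

lemma add_mem_cone {x y : L1 τ} (hx : x ∈ cone τ) (hy : y ∈ cone τ) : x + y ∈ cone τ := by
  refine map_mem_closure₂ continuous_add hx hy ?_
  rintro _ ⟨a, ha, rfl⟩ _ ⟨b, hb, rfl⟩
  refine ⟨a + b, ?_, UniformSpace.Completion.coe_add a b⟩
  simp only [Set.mem_ofPred_eq, map_add] at *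
  exact ha.add hb

lemma norm_add_of_mem_cone {x y : L1 τ} (hx : x ∈ cone τ) (hy : y ∈ cone τ) :
    ‖x + y‖ = ‖x‖ + ‖y‖ := by
  have h : (x, y) ∈ closure (((fun a : PreL1 τ => (a : L1 τ)) '' {a | IsPos a.val}) ×ˢ
      ((fun a : PreL1 τ => (a : L1 τ)) '' {a | IsPos a.val})) := by
    rw [closure_prod_eq]
    exact ⟨hx, hy⟩
  refine closure_minimal (t := {z : L1 τ × L1 τ | ‖z.1 + z.2‖ = ‖z.1‖ + ‖z.2‖}) ?_
    (isClosed_eq (by fun_prop) (by fun_prop)) h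
  rintro ⟨_, _⟩ ⟨⟨a, ha, rfl⟩, ⟨b, hb, rfl⟩⟩
  simp only [Set.mem_ofPred_eq]
  rw [← UniformSpace.Completion.coe_add, UniformSpace.Completion.norm_coe,
    UniformSpace.Completion.norm_coe, UniformSpace.Completion.norm_coe,
    PreL1.norm_add_of_isPos ha hb]

lemma opNorm_le_of_le_on_cone (R : L1 τ →L[ℝ] L1 τ) {c : ℝ} (hc : 0 ≤ c)
    (h : ∀ x ∈ cone τ, ‖R x‖ ≤ c * ‖x‖) : ‖R‖ ≤ c := by
  -- The bound for seminorms needs a positive constant.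
  refine le_of_forall_gt_imp_ge_of_dense fun C hC => ?_
  have hC0 : 0 < C := hc.trans_lt hC
  refine R.opNorm_le_bound hC0.le fun x => ?_
  induction x using UniformSpace.Completion.induction_on with
  | hp => exact isClosed_le (by fun_prop) (by fun_prop)
  | ih a =>
    have h1 := PreL1.seminorm_le_of_le_on_isPos ((normSeminorm ℝ (L1 τ)).comp
      (R.toLinearMap ∘ₗ (UniformSpace.Completion.toComplL (𝕜 := ℝ)).toLinearMap)) hC0
      (fun b hb => by
        have hb' := h (b : L1 τ) (subset_closure ⟨b, hb, rfl⟩)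
        rw [UniformSpace.Completion.norm_coe] at hb'
        exact hb'.trans (by gcongr)) a
    rw [UniformSpace.Completion.norm_coe]
    exact h1

end L1

end TraceNorm

/-! ### Powers of positive contractions -/

section Contractions

variable {X : Type v} [NormedAddCommGroup X] [NormedSpace ℝ X] {P : Set X}

lemma IsPositiveOp.pow {T : X →L[ℝ] X} (hT : IsPositiveOp P T) (n : ℕ) :
    IsPositiveOp P (T ^ n) := by
  induction n with
  | zero => exact fun x hx => hx
  | succ n ih => rw [pow_succ]; exact fun x hx => ih _ (hT x hx)

lemma OpLe.pow (hadd : ∀ x ∈ P, ∀ y ∈ P, x + y ∈ P) {T S : X →L[ℝ] X} (hT : IsPositiveOp P T)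
    (hS : IsPositiveOp P S) (h : OpLe P T S) {n : ℕ} (hn : 1 ≤ n) : OpLe P (T ^ n) (S ^ n) := by
  induction n, hn using Nat.le_induction with
  | base => simpa using h
  | succ n hn ih =>
    intro x hx
    have h1 : (S ^ (n + 1) - T ^ (n + 1)) x = (S ^ n) ((S - T) x) + (S ^ n - T ^ n) (T x) := by
      simp [pow_succ]
    rw [h1]
    exact hadd _ (hS.pow n _ (h x hx)) _ (ih _ (hT x hx))

lemma norm_apply_le_of_norm_le_one {T : X →L[ℝ] X} (hT : ‖T‖ ≤ 1) (x : X) : ‖T x‖ ≤ ‖x‖ := by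
  simpa using T.le_of_opNorm_le hT x

lemma norm_pow_apply_le_of_norm_le_one {T : X →L[ℝ] X} (hT : ‖T‖ ≤ 1) (n : ℕ) (x : X) :
    ‖(T ^ n) x‖ ≤ ‖x‖ := by
  induction n generalizing x with
  | zero => simp
  | succ n ih => rw [pow_succ]; exact (ih _).trans (norm_apply_le_of_norm_le_one hT x)

/-- With `d = ‖Sⁿ - Tⁿ‖` and `x` positive of norm `1`, additivity of the norm bounds
`‖(Sⁿ⁺¹ - Tⁿ⁺¹) x‖` both by `1 - (1 - d) ‖T x‖` and by `d + ‖T x‖`. A convex combination of these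
bounds does not depend on `‖T x‖` and is less than `1`. -/
theorem norm_pow_sub_pow_lt_one (hadd : ∀ x ∈ P, ∀ y ∈ P, x + y ∈ P)
    (hnorm : ∀ x ∈ P, ∀ y ∈ P, ‖x + y‖ = ‖x‖ + ‖y‖)
    (hop : ∀ R : X →L[ℝ] X, IsPositiveOp P R → ∀ c : ℝ, 0 ≤ c →
      (∀ x ∈ P, ‖R x‖ ≤ c * ‖x‖) → ‖R‖ ≤ c)
    {T S : X →L[ℝ] X} (hT : IsPositiveContraction P T) (hS : IsPositiveContraction P S)
    (hTS : OpLe P T S) {n₀ : ℕ} (hn₀ : 1 ≤ n₀) (h : ‖S ^ n₀ - T ^ n₀‖ < 1) {n : ℕ}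
    (hn : n₀ ≤ n) : ‖S ^ n - T ^ n‖ < 1 := by
  induction n, hn using Nat.le_induction with
  | base => exact h
  | succ n hn ih =>
    have hn1 : 1 ≤ n := hn₀.trans hn
    set d := ‖S ^ n - T ^ n‖ with hd
    have hd0 : 0 ≤ d := norm_nonneg _
    -- Additivity of the norm, for `T ^ k ≤ S ^ k`.
    have hsub : ∀ k, 1 ≤ k → ∀ x ∈ P, ‖(S ^ k - T ^ k) x‖ = ‖(S ^ k) x‖ - ‖(T ^ k) x‖ := by
      intro k hk x hx
      rw [eq_sub_iff_add_eq, ← hnorm _ (hTS.pow hadd hT.1 hS.1 hk x hx) _ (hT.1.pow k x hx)]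
      simp
    have hle : ‖S ^ (n + 1) - T ^ (n + 1)‖ ≤ (1 + d - d ^ 2) / (2 - d) := by
      refine hop _ (hTS.pow hadd hT.1 hS.1 n.succ_pos) _
        (div_nonneg (by nlinarith) (by linarith)) fun x hx => ?_
      rw [hsub _ n.succ_pos x hx, pow_succ, pow_succ]
      change ‖(S ^ n) (S x)‖ - ‖(T ^ n) (T x)‖ ≤ _
      have hTx := hT.1 x hx
      have hS1 : ‖(S ^ n) (S x)‖ = ‖(S ^ n) (T x)‖ + ‖(S ^ n) ((S - T) x)‖ := by
        rw [← hnorm _ (hS.1.pow n _ hTx) _ (hS.1.pow n _ (hTS x hx)), ← map_add]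
        simp
      have h1 := (S ^ n - T ^ n).le_opNorm (T x)
      rw [hsub n hn1 _ hTx] at h1
      have h2 : ‖(S ^ n) ((S - T) x)‖ ≤ ‖S x‖ - ‖T x‖ := by
        refine (norm_pow_apply_le_of_norm_le_one hS.2 n _).trans_eq ?_
        simpa using hsub 1 le_rfl x hx
      have h3 : ‖S x‖ ≤ ‖x‖ := norm_apply_le_of_norm_le_one hS.2 x
      have h4 : ‖(S ^ n) (S x)‖ ≤ ‖(S ^ n) x‖ := by
        have h : (S ^ n) (S x) = S ((S ^ n) x) := by
          change (S ^ n * S) x = (S * S ^ n) x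
          rw [← pow_succ, ← pow_succ']
        rw [h]
        exact norm_apply_le_of_norm_le_one hS.2 _
      have h5 := (S ^ n - T ^ n).le_opNorm x
      rw [hsub n hn1 _ hx] at h5
      have h6 : ‖(T ^ n) x‖ ≤ ‖T x‖ := by
        obtain ⟨k, rfl⟩ : ∃ k, n = k + 1 := ⟨n - 1, by omega⟩
        rw [pow_succ]
        exact norm_pow_apply_le_of_norm_le_one hT.2 k (T x)
      rw [← hd] at h1 h5
      have h7 : 0 ≤ ‖(T ^ n) (T x)‖ := norm_nonneg _
      rw [div_mul_eq_mul_div, le_div_iff₀ (by linarith)]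
      have b1 : ‖(S ^ n) (S x)‖ - ‖(T ^ n) (T x)‖ ≤ ‖x‖ - (1 - d) * ‖T x‖ := by linarith
      have b2 : ‖(S ^ n) (S x)‖ - ‖(T ^ n) (T x)‖ ≤ d * ‖x‖ + ‖T x‖ := by linarith
      linarith [mul_le_mul_of_nonneg_left b2 (by linarith : 0 ≤ 1 - d)]
    refine hle.trans_lt ?_
    rw [div_lt_one (by linarith)]
    nlinarith [sq_pos_of_pos (sub_pos.2 ih)]

end Contractions

end

/-! ### Application to `L₁(A, τ)` and to ordered Banach spaces -/

theorem theorem3p3 :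
    (∀ (A : Type u) [JBWAlgebra A] (τ : FNSTrace A) (T S : L1 τ →L[ℝ] L1 τ),
      IsPositiveContraction (L1.cone τ) T → IsPositiveContraction (L1.cone τ) S →
      OpLe (L1.cone τ) T S →
      ∀ n₀ : ℕ, 1 ≤ n₀ → ‖S ^ n₀ - T ^ n₀‖ < 1 → ∀ n : ℕ, n₀ ≤ n → ‖S ^ n - T ^ n‖ < 1) ∧
    (∀ (X : Type v) [NormedAddCommGroup X] [NormedSpace ℝ X] [CompleteSpace X]
      [PartialOrder X] [IsOrderedAddMonoid X] [IsOrderedModule ℝ X],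
      (∀ x y : X, 0 ≤ x → 0 ≤ y → ‖x + y‖ = ‖x‖ + ‖y‖) →
      (∀ R : X →L[ℝ] X, IsPositiveOp {x | 0 ≤ x} R →
        ‖R‖ = sSup {r : ℝ | ∃ x : X, 0 ≤ x ∧ ‖x‖ = 1 ∧ r = ‖R x‖}) →
      ∀ T S : X →L[ℝ] X,
      IsPositiveContraction {x | 0 ≤ x} T → IsPositiveContraction {x | 0 ≤ x} S →
      OpLe {x | 0 ≤ x} T S →
      ∀ n₀ : ℕ, 1 ≤ n₀ → ‖S ^ n₀ - T ^ n₀‖ < 1 → ∀ n : ℕ, n₀ ≤ n → ‖S ^ n - T ^ n‖ < 1) := by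
  refine ⟨fun A _ τ T S hT hS hTS n₀ hn₀ h n hn => ?_,
    fun X _ _ _ _ _ _ hnorm hop T S hT hS hTS n₀ hn₀ h n hn => ?_⟩
  · exact norm_pow_sub_pow_lt_one (fun x hx y hy => L1.add_mem_cone hx hy)
      (fun x hx y hy => L1.norm_add_of_mem_cone hx hy)
      (fun R _ c hc hR => L1.opNorm_le_of_le_on_cone R hc hR) hT hS hTS hn₀ h hn
  · refine norm_pow_sub_pow_lt_one (fun x hx y hy => add_nonneg hx hy)
      (fun x hx y hy => hnorm x y hx hy) (fun R hR c hc hRc => ?_) hT hS hTS hn₀ h hn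
    rw [hop R hR]
    refine Real.sSup_le ?_ hc
    rintro _ ⟨x, hx, hx1, rfl⟩
    simpa [hx1] using hRc x hx
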